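/- Let $B=\left(\frac{a,b}{\mathbb{Q}}\right)$ be an indefinite quaternion algebra over $\mathbb{Q}$ (that is, $B\otimes\mathbb{R}$ is not a division algebra), let $\mathfrak{D}$ be its discriminant (the product of the primes $p$ for which $B\otimes\mathbb{Q}_p$ is a division algebra), and let $\mathrm{trd},\mathrm{nrd}$ be the reduced trace and norm. Let $\mathrm{O}$ be an Eichler order of $B$ (an order that is the intersection of two maximal orders) of level $\mathfrak{M}$, i.e. of reduced discriminant $\mathfrak{D}\mathfrak{M}$. For a discriminant $D$ (a non-square integer $D\equiv 0,1\pmod 4$) let $\mathcal{O}_D\subset\mathbb{Q}(\sqrt{D})$ be the quadratic order of discriminant $D$. An optimal embedding of discriminant $D$ into $\mathrm{O}$ is a ring homomorphism $\phi:\mathcal{O}_D\to\mathrm{O}$ that does not extend to a ring homomorphism into $\mathrm{O}$ of a strictly larger order of $\mathbb{Q}(\sqrt{D})$. For a place $v$ of $\mathbb{Q}$ put $\mathrm{O}_v=\mathrm{O}\otimes\mathbb{Z}_p$ if $v=p$ is a prime, and $\mathrm{O}_\infty=B\otimes\mathbb{R}$. The orientation of $\phi$ is the family $(o_v(\phi))_v$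 over all places $v$ of $\mathbb{Q}$, where $o_v(\phi)$ is the class of the induced embedding $\phi_v:\mathcal{O}_D\to\mathrm{O}_v$ under conjugation by the elements of $\mathrm{O}_v$ of reduced norm $1$. Let $D_1,D_2$ be positive discriminants, and let $o_1,o_2$ be orientations of optimal embeddings of discriminants $D_1,D_2$, respectively, into $\mathrm{O}$. Then there exists an integer $x_{o_1,o_2}$ such that for all optimal embeddings $\phi_1,\phi_2$ into $\mathrm{O}$ of discriminants $D_1,D_2$ and of orientations $o_1,o_2$, the number $\frac12\mathrm{trd}\left(\phi_1(\sqrt{D_1})\phi_2(\sqrt{D_2})\right)$ is an integer and $$x_{o_1,o_2}\equiv\frac{1}{2}\mathrm{trd}\left(\phi_1(\sqrt{D_1})\phi_2(\sqrt{D_2})\right)\pmod{2\mathfrak{D}\mathfrak{M}}.$$ Call $(\phi_1,\phi_2)$ $x$-linked, for an integer $x$ with $x^2\neq D_1D_2$, if $x=\frac12\mathrm{trd}\left(\phi_1(\sqrt{D_1})\phi_2(\sqrt{D_2})\right)$. In particular, all integers $x$ for which there is an $x$-linked pair of optimal embeddings of discriminants $D_1,D_2$ and orientations $o_1,o_2$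 are congruent modulo $2\mathfrak{D}\mathfrak{M}$. -/

import Mathlib

open scoped Quaternion

namespace ShimuraLinking

noncomputable section

/-! ## Quaternion algebras

`ℍ[F,a,b]` is Mathlib's quaternion algebra with `i ^ 2 = a`, `j ^ 2 = b`, `k = i * j = -j * i`. -/

/-- The reduced trace `x + x̄` on `ℍ[F,a,b]`. -/
def trd {F : Type*} [Field F] {a b : F} (x : ℍ[F,a,b]) : F := 2 * x.re

/-- The reduced norm `x * x̄` on `ℍ[F,a,b]`. -/
def nrd {F : Type*} [Field F] {a b : F} (x : ℍ[F,a,b]) : F :=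
  x.re ^ 2 - a * x.imI ^ 2 - b * x.imJ ^ 2 + a * b * x.imK ^ 2

theorem add_star_eq_trd {F : Type*} [Field F] {a b : F} (x : ℍ[F,a,b]) :
    x + star x = ⟨trd x, 0, 0, 0⟩ := by
  ext <;> simp [trd]
  ring

theorem mul_star_eq_nrd {F : Type*} [Field F] {a b : F} (x : ℍ[F,a,b]) :
    x * star x = ⟨nrd x, 0, 0, 0⟩ := by
  ext <;> simp [nrd] <;> ring

/-- The quaternion algebra `(a,b / F)` is a division algebra. -/
def IsDivision (F : Type*) [Field F] (a b : F) : Prop :=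
  ∀ x : ℍ[F,a,b], x ≠ 0 → IsUnit x

/-- The inclusion of `(a,b / ℚ)` into `(a,b / F) = (a,b / ℚ) ⊗ F`. -/
def baseChange (F : Type*) [Field F] [CharZero F] (a b : ℚ) :
    ℍ[ℚ,a,b] →+* ℍ[F,(a : F),(b : F)] where
  toFun x := ⟨(x.re : F), (x.imI : F), (x.imJ : F), (x.imK : F)⟩
  map_one' := by ext <;> simp
  map_zero' := by ext <;> simp
  map_add' x y := by ext <;> simp
  map_mul' x y := by ext <;> simp

instance factPrime (p : Nat.Primes) : Fact (p : ℕ).Prime := ⟨p.2⟩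

/-- The prime `p` ramifies in `(a,b / ℚ)`. -/
def IsRamifiedAt (a b : ℚ) (p : Nat.Primes) : Prop := IsDivision ℚ_[p] (a : ℚ_[p]) (b : ℚ_[p])

/-- `(a,b / ℚ)` is indefinite, i.e. split at the infinite place. -/
def IsIndefinite (a b : ℚ) : Prop := ¬ IsDivision ℝ (a : ℝ) (b : ℝ)

/-- The discriminant `𝔇` of `(a,b / ℚ)`: the product of the (finitely many) ramified primes. -/
def discriminant (a b : ℚ) : ℕ := ∏ᶠ p ∈ {p : Nat.Primes | IsRamifiedAt a b p}, (p : ℕ)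

/-! ## Orders -/

/-- A subring of a `ℚ`-algebra is an order if it is a full `ℤ`-lattice. -/
def IsOrder {A : Type*} [Ring A] [Algebra ℚ A] (O : Subring A) : Prop :=
  O.toAddSubgroup.FG ∧ Submodule.span ℚ (O : Set A) = ⊤

/-- An order that is not properly contained in another order. -/
def IsMaximalOrder {A : Type*} [Ring A] [Algebra ℚ A] (O : Subring A) : Prop :=
  IsOrder O ∧ ∀ O' : Subring A, IsOrder O' → O ≤ O' → O' = O

/-- `N` is the reduced discriminant of `O`: `N ^ 2 = -det (trd (αᵢ * αⱼ))` for a `ℤ`-basis `α`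
of `O`. -/
def HasReducedDiscriminant {a b : ℚ} (O : Subring ℍ[ℚ,a,b]) (N : ℕ) : Prop :=
  ∃ α : Module.Basis (Fin 4) ℤ O,
    (N : ℚ) ^ 2 = -(Matrix.of fun i j : Fin 4 =>
      trd ((α i : ℍ[ℚ,a,b]) * (α j : ℍ[ℚ,a,b]))).det

/-- `O` is an Eichler order (an order that is the intersection of two maximal orders)
of level `M`, i.e. with reduced discriminant `𝔇 * M`. -/
def IsEichlerOrderOfLevel {a b : ℚ} (O : Subring ℍ[ℚ,a,b]) (M : ℕ) : Prop :=
  IsOrder O ∧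
  (∃ O₁ O₂ : Subring ℍ[ℚ,a,b], IsMaximalOrder O₁ ∧ IsMaximalOrder O₂ ∧ O = O₁ ⊓ O₂) ∧
  HasReducedDiscriminant O (discriminant a b * M)

/-- The `ℤ_p`-span of `O` in `B_p`, i.e. `O_p = O ⊗ ℤ_p`. -/
def localOrder {a b : ℚ} (O : Subring ℍ[ℚ,a,b]) (p : Nat.Primes) :
    Subring ℍ[ℚ_[p],(a : ℚ_[p]),(b : ℚ_[p])] :=
  ((Submodule.span ℤ_[p]
      (baseChange ℚ_[p] a b '' (O : Set ℍ[ℚ,a,b]))).toSubalgebra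
    (Submodule.subset_span ⟨1, O.one_mem, map_one _⟩)
    (fun x y hx hy => by
      have h := Submodule.mul_mem_mul hx hy
      rw [Submodule.span_mul_span] at h
      refine Submodule.span_mono ?_ h
      rintro _ ⟨_, ⟨u, hu, rfl⟩, _, ⟨v, hv, rfl⟩, rfl⟩
      exact ⟨u * v, O.mul_mem hu hv, map_mul _ _ _⟩)).toSubring

theorem baseChange_mem_localOrder {a b : ℚ} (O : Subring ℍ[ℚ,a,b]) (p : Nat.Primes)
    {x : ℍ[ℚ,a,b]} (hx : x ∈ O) : baseChange ℚ_[p] a b x ∈ localOrder O p :=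
  Submodule.subset_span (Set.mem_image_of_mem _ hx)

/-- The inclusion `O → O_p`. -/
def toLocal {a b : ℚ} (O : Subring ℍ[ℚ,a,b]) (p : Nat.Primes) : O →+* localOrder O p :=
  ((baseChange ℚ_[p] a b).comp O.subtype).codRestrict (localOrder O p)
    (fun x => baseChange_mem_localOrder O p x.2)

/-- At the infinite place the local order is all of `B_∞`. -/
def toInfinity {a b : ℚ} (O : Subring ℍ[ℚ,a,b]) :
    O →+* (⊤ : Subring ℍ[ℝ,(a : ℝ),(b : ℝ)]) :=
  ((baseChange ℝ a b).comp O.subtype).codRestrict ⊤ (fun _ => Subring.mem_top _)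

/-! ## Quadratic orders and optimal embeddings -/

/-- The discriminants of quadratic orders. -/
def IsDiscriminant (D : ℤ) : Prop := (D % 4 = 0 ∨ D % 4 = 1) ∧ ¬ IsSquare D

/-- The quadratic algebra `ℚ(√D)`; `⟨u, v⟩` stands for `u + v √D`. -/
abbrev QuadField (D : ℤ) : Type := QuadraticAlgebra ℚ (D : ℚ) 0

/-- The quadratic order `ℤ[(p_D + √D) / 2]` of discriminant `D`, where `p_D ∈ {0, 1}` is the parity
of `D`. -/
def quadOrder (D : ℤ) : Subring (QuadField D) :=
  Subring.closure {⟨((D % 2 : ℤ) : ℚ) / 2, 1 / 2⟩}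

theorem sqrt_mem_quadOrder (D : ℤ) : (⟨0, 1⟩ : QuadField D) ∈ quadOrder D := by
  have h : (⟨((D % 2 : ℤ) : ℚ) / 2, 1 / 2⟩ : QuadField D) ∈ quadOrder D :=
    Subring.subset_closure rfl
  have h2 := (quadOrder D).sub_mem ((quadOrder D).add_mem h h)
    (intCast_mem (quadOrder D) (D % 2))
  convert h2 using 1
  ext
  · simp
  · simp; norm_num

/-- The element `√D` of the quadratic order of discriminant `D`. -/
def sqrtD (D : ℤ) : quadOrder D := ⟨⟨0, 1⟩, sqrt_mem_quadOrder D⟩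

/-- An embedding of the quadratic order into `O` is optimal if it does not extend to an
embedding into `O` of a strictly larger order of `ℚ(√D)`. -/
def IsOptimal {a b : ℚ} {D : ℤ} {O : Subring ℍ[ℚ,a,b]} (φ : quadOrder D →+* O) : Prop :=
  ∀ (S : Subring (QuadField D)) (hS : quadOrder D < S), IsOrder S →
    ¬ ∃ ψ : S →+* O, ψ.comp (Subring.inclusion hS.le) = φ

/-! ## Orientations -/

/-- Equivalence of embeddings into `Λ`: conjugation by an element of reduced norm one of `Λ`.
(In an order, the elements of norm one are units, with `r⁻¹ = r̄`.) -/
def embSetoid {F : Type*} [Field F] {a b : F} (D : ℤ) (Λ : Subring ℍ[F,a,b]) :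
    Setoid (quadOrder D →+* Λ) where
  r φ ψ := ∃ r : Λˣ, nrd ((r : Λ) : ℍ[F,a,b]) = 1 ∧
    ∀ z, ψ z = (r : Λ) * φ z * ((r⁻¹ : Λˣ) : Λ)
  iseqv := by
    have key : ∀ x y : ℍ[F,a,b], nrd (x * y) = nrd x * nrd y := by
      intro x y
      simp only [nrd, QuaternionAlgebra.re_mul, QuaternionAlgebra.imI_mul,
        QuaternionAlgebra.imJ_mul, QuaternionAlgebra.imK_mul]
      ring
    have h1 : nrd (1 : ℍ[F,a,b]) = 1 := by simp [nrd]
    refine ⟨fun φ => ⟨1, by simpa using h1, fun z => by simp⟩, ?_, ?_⟩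
    · rintro φ ψ ⟨r, hr, h⟩
      refine ⟨r⁻¹, ?_, fun z => by rw [h]; simp [mul_assoc]⟩
      have h2 := key ((r : Λ) : ℍ[F,a,b]) ((r⁻¹ : Λˣ) : Λ)
      rw [← Subring.coe_mul, Units.mul_inv, Subring.coe_one, h1, hr, one_mul] at h2
      exact h2.symm
    · rintro φ ψ χ ⟨r, hr, h⟩ ⟨s, hs, h'⟩
      refine ⟨s * r, ?_, fun z => by rw [h', h]; simp [mul_assoc]⟩
      rw [Units.val_mul, Subring.coe_mul, key, hr, hs, one_mul]

/-- A family of equivalence classes of local embeddings, one at each place of `ℚ`. -/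
@[ext]
structure EmbOrientation {a b : ℚ} (O : Subring ℍ[ℚ,a,b]) (D : ℤ) where
  atPrime : ∀ p : Nat.Primes, Quotient (embSetoid D (localOrder O p))
  atInfinity : Quotient (embSetoid D (⊤ : Subring ℍ[ℝ,(a : ℝ),(b : ℝ)]))

/-- The orientation of an embedding: the equivalence classes of its localizations. -/
def orientation {a b : ℚ} {D : ℤ} {O : Subring ℍ[ℚ,a,b]} (φ : quadOrder D →+* O) :
    EmbOrientation O D where
  atPrime p := Quotient.mk _ ((toLocal O p).comp φ)
  atInfinity := Quotient.mk _ ((toInfinity O).comp φ)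

/-- The optimal embeddings of discriminant `D` into `O` with orientation `o`. -/
def optimalEmbeddings {a b : ℚ} {D : ℤ} {O : Subring ℍ[ℚ,a,b]} (o : EmbOrientation O D) :
    Set (quadOrder D →+* O) :=
  {φ | IsOptimal φ ∧ orientation φ = o}

/-! ## Linking -/

/-- The number `(1 / 2) * trd (φ₁(√D₁) * φ₂(√D₂))`. -/
def linking {a b : ℚ} {D₁ D₂ : ℤ} {O : Subring ℍ[ℚ,a,b]} (φ₁ : quadOrder D₁ →+* O)
    (φ₂ : quadOrder D₂ →+* O) : ℚ :=
  1 / 2 * trd ((φ₁ (sqrtD D₁) : ℍ[ℚ,a,b]) * (φ₂ (sqrtD D₂) : ℍ[ℚ,a,b]))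

/-- The pair `(φ₁, φ₂)` is `x`-linked. -/
def IsLinked {a b : ℚ} {D₁ D₂ : ℤ} {O : Subring ℍ[ℚ,a,b]} (x : ℤ) (φ₁ : quadOrder D₁ →+* O)
    (φ₂ : quadOrder D₂ →+* O) : Prop :=
  x ^ 2 ≠ D₁ * D₂ ∧ (x : ℚ) = linking φ₁ φ₂

end

end ShimuraLinking

open ShimuraLinking

namespace ShimuraLinking

/-! ### The trilinear form `trd ([x, y] * z)` and its determinant formula. -/

section Trace

variable {F : Type*} [Field F] {a b : F}

/-! Fix one embedding and conjugate the other locally by a unit `r` of `O_p`. Then `trd (r x r⁻¹ y)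
- trd (x y) = trd ([r, x] r⁻¹ y)` (`trd_conj_mul_sub`). The form `trd ([x, y] z)` is a constant
times the determinant of `1, x, y, z`, and the reduced discriminant `N` is, up to sign, the same
constant times the determinant of a basis. So the form is `N ℤ`-valued on `O` (`exists_commForm_eq`)
and `N ℤ_p`-valued on `O_p`.

Writing `√D = 2g - (D % 2)` with `g` the generator of the quadratic order, the linking number is `2
trd (g₁ g₂)` plus terms invariant under conjugation. It therefore changes by an element of `2N ℤ_p`
for each `p`, hence by a multiple of `2N`. -/

theorem trd_mul_comm (x y : ℍ[F,a,b]) : trd (x * y) = trd (y * x) := by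
  simp only [trd, QuaternionAlgebra.re_mul]
  ring

/-- The trilinear form `trd ([x, y] * z)`. -/
def commForm (x y z : ℍ[F,a,b]) : F := trd ((x * y - y * x) * z)

theorem commForm_rotate (x y z : ℍ[F,a,b]) : commForm x y z = commForm y z x := by
  simp only [commForm, sub_mul, trd, QuaternionAlgebra.re_sub, QuaternionAlgebra.re_mul,
    QuaternionAlgebra.imI_mul, QuaternionAlgebra.imJ_mul, QuaternionAlgebra.imK_mul]
  ring

/-- The coordinates of a quaternion in the basis `1, i, j, k`. -/
def coords (x : ℍ[F,a,b]) : Fin 4 → F := ![x.re, x.imI, x.imJ, x.imK]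

/-- Both sides are alternating and trilinear and vanish when an argument is scalar, so the value at
`i, j, k` decides: `trd (2k * k) = -4ab`. -/
theorem commForm_eq_det (x y z : ℍ[F,a,b]) :
    commForm x y z = -(4 * a * b) * (Matrix.of ![coords (1 : ℍ[F,a,b]), coords x, coords y, coords z]).det := by
  simp only [commForm, sub_mul, trd, QuaternionAlgebra.re_sub, QuaternionAlgebra.re_mul,
    QuaternionAlgebra.imI_mul, QuaternionAlgebra.imJ_mul, QuaternionAlgebra.imK_mul, coords]
  simp [Matrix.det_succ_row_zero, Fin.sum_univ_succ, Fin.succAbove]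
  ring

theorem trd_mul_eq_coords (x y : ℍ[F,a,b]) :
    trd (x * y) = ∑ k, coords x k * (![2, 2 * a, 2 * b, -(2 * a * b)] k * coords y k) := by
  simp [trd, coords, Fin.sum_univ_succ]
  ring

/-- The trace form is diagonal in `1, i, j, k`, with determinant `-(4ab)²`. The constant `4ab`
matches the one in `commForm_eq_det`. -/
theorem det_trd_mul (α : Fin 4 → ℍ[F,a,b]) :
    (Matrix.of fun i j => trd (α i * α j)).det =
      -(4 * a * b * (Matrix.of fun i => coords (α i)).det) ^ 2 := by
  have h : (Matrix.of fun i j => trd (α i * α j)) =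
      (Matrix.of fun i => coords (α i)) *
        (Matrix.diagonal ![2, 2 * a, 2 * b, -(2 * a * b)] *
          (Matrix.of fun i => coords (α i)).transpose) := by
    ext i j
    rw [Matrix.mul_apply]
    simp only [Matrix.diagonal_mul, Matrix.of_apply, Matrix.transpose_apply]
    exact trd_mul_eq_coords _ _
  rw [h, Matrix.det_mul, Matrix.det_mul, Matrix.det_transpose, Matrix.det_diagonal]
  simp [Fin.prod_univ_succ]
  ring

/-- Conjugating `x` by a unit changes `trd (x * y)` by a value of `commForm`. -/
theorem trd_conj_mul_sub {r s : ℍ[F,a,b]} (h : r * s = 1) (x y : ℍ[F,a,b]) :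
    trd (r * x * s * y) - trd (x * y) = commForm r x (s * y) := by
  have hx : x * y = x * r * (s * y) := by
    rw [mul_assoc, ← mul_assoc r, h, one_mul]
  rw [hx]
  simp only [commForm, sub_mul, mul_assoc]
  simp only [trd, QuaternionAlgebra.re_sub, mul_sub]

/-- Linearity in the last slot suffices, since cyclic rotation brings each argument there in turn.
-/
theorem commForm_mem_of_mem_span {R : Type*} [CommRing R] [Algebra R F] {S : Set ℍ[F,a,b]}
    {I : Submodule R F} (h : ∀ x ∈ S, ∀ y ∈ S, ∀ z ∈ S, commForm x y z ∈ I) :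
    ∀ x ∈ Submodule.span R S, ∀ y ∈ Submodule.span R S, ∀ z ∈ Submodule.span R S,
      commForm x y z ∈ I := by
  have last : ∀ x y : ℍ[F,a,b], (∀ z ∈ S, commForm x y z ∈ I) →
      ∀ z ∈ Submodule.span R S, commForm x y z ∈ I := by
    intro x y hS z hz
    induction hz using Submodule.span_induction with
    | mem z hz => exact hS z hz
    | zero => simp [commForm, trd]
    | add u v _ _ hu hv =>
      have : commForm x y (u + v) = commForm x y u + commForm x y v := by
        simp only [commForm, mul_add, trd, QuaternionAlgebra.re_add]
      rw [this]
      exact I.add_mem hu hv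
    | smul c u _ hu =>
      have : commForm x y (c • u) = c • commForm x y u := by
        simp only [commForm, trd, mul_smul_comm, QuaternionAlgebra.re_smul]
      rw [this]
      exact I.smul_mem c hu
  intro x hx y hy z hz
  refine last x y (fun z hz => ?_) z hz
  rw [← commForm_rotate]
  refine last z x (fun y hy => ?_) y hy
  rw [← commForm_rotate]
  refine last y z (fun x hx => ?_) x hx
  rw [← commForm_rotate]
  exact h x hx y hy z hz

end Trace

theorem trd_baseChange (F : Type*) [Field F] [CharZero F] {a b : ℚ} (x : ℍ[ℚ,a,b]) :
    trd (baseChange F a b x) = ((trd x : ℚ) : F) := by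
  simp [trd, baseChange]

theorem commForm_baseChange (F : Type*) [Field F] [CharZero F] {a b : ℚ} (x y z : ℍ[ℚ,a,b]) :
    commForm (baseChange F a b x) (baseChange F a b y) (baseChange F a b z) =
      ((commForm x y z : ℚ) : F) := by
  rw [commForm, ← map_mul, ← map_mul, ← map_sub, ← map_mul, trd_baseChange, commForm]

/-! ### Integrality of the form and of the reduced trace on an order. -/

section Order

variable {a b : ℚ} {O : Subring ℍ[ℚ,a,b]}

/-- The form `trd ([x, y] * z)` takes values in `N ℤ` on an order of reduced discriminant `N`. -/
theorem exists_commForm_eq {N : ℕ} (hN : HasReducedDiscriminant O N) {x y z : ℍ[ℚ,a,b]}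
    (hx : x ∈ O) (hy : y ∈ O) (hz : z ∈ O) : ∃ c : ℤ, commForm x y z = N * c := by
  obtain ⟨α, hα⟩ := hN
  rw [det_trd_mul (fun i => (α i : ℍ[ℚ,a,b])), neg_neg] at hα
  -- The determinant has `1` as its first row; as `1 ∈ O`, all four rows have integer coordinates in
  -- the basis `α`.
  let v : Fin 4 → O := ![1, ⟨x, hx⟩, ⟨y, hy⟩, ⟨z, hz⟩]
  let C : Matrix (Fin 4) (Fin 4) ℤ := Matrix.of fun i j => α.repr (v i) j
  have hC : (Matrix.of ![coords (1 : ℍ[ℚ,a,b]), coords x, coords y, coords z]) =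
      C.map (Int.castRingHom ℚ) * Matrix.of fun i => coords (α i : ℍ[ℚ,a,b]) := by
    have h1 : (Matrix.of ![coords (1 : ℍ[ℚ,a,b]), coords x, coords y, coords z]) =
        Matrix.of fun i => coords (v i : ℍ[ℚ,a,b]) := by
      ext i j
      fin_cases i <;> rfl
    rw [h1]
    ext i j
    have h2 : (v i : ℍ[ℚ,a,b]) = ∑ k, (C i k) • (α k : ℍ[ℚ,a,b]) := by
      conv_lhs => rw [← α.sum_repr (v i)]
      simp [C]
    rw [Matrix.mul_apply]
    simp only [Matrix.of_apply, Matrix.map_apply, h2, Fin.sum_univ_four]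
    fin_cases j <;> simp [coords]
  have hdet := commForm_eq_det x y z
  rw [hC, Matrix.det_mul, ← RingHom.mapMatrix_apply, ← RingHom.map_det] at hdet
  -- The discriminant fixes `4ab * det α` only up to sign.
  rcases sq_eq_sq_iff_eq_or_eq_neg.mp hα with h | h
  · refine ⟨-C.det, ?_⟩
    rw [hdet, h, eq_intCast, Int.cast_neg]
    ring
  · refine ⟨C.det, ?_⟩
    rw [hdet, h, eq_intCast]
    ring

theorem exists_commForm_localOrder_eq {N : ℕ} (hN : HasReducedDiscriminant O N) (p : Nat.Primes)
    {x y z : ℍ[ℚ_[p],(a : ℚ_[p]),(b : ℚ_[p])]}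
    (hx : x ∈ localOrder O p) (hy : y ∈ localOrder O p) (hz : z ∈ localOrder O p) :
    ∃ c : ℤ_[p], commForm x y z = N * c := by
  have h : commForm x y z ∈ Submodule.span ℤ_[p] {(N : ℚ_[p])} := by
    refine commForm_mem_of_mem_span ?_ x hx y hy z hz
    rintro _ ⟨x, hx, rfl⟩ _ ⟨y, hy, rfl⟩ _ ⟨z, hz, rfl⟩
    obtain ⟨c, hc⟩ := exists_commForm_eq hN hx hy hz
    rw [commForm_baseChange, hc, Submodule.mem_span_singleton]
    refine ⟨c, ?_⟩
    rw [Algebra.smul_def, mul_comm]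
    simp
  obtain ⟨c, hc⟩ := Submodule.mem_span_singleton.mp h
  exact ⟨c, by rw [← hc, Algebra.smul_def, mul_comm]; rfl⟩

theorem IsOrder.isIntegral (hO : IsOrder O) {x : ℍ[ℚ,a,b]} (hx : x ∈ O) : IsIntegral ℤ x := by
  refine IsIntegral.of_mem_of_fg (subalgebraOfSubring O) ?_ x hx
  exact (Submodule.fg_iff_addSubgroup_fg _).mpr hO.1

/-- The reduced trace of an integral quaternion is an integer. -/
theorem exists_int_eq_trd {x : ℍ[ℚ,a,b]} (hx : IsIntegral ℤ x) : ∃ t : ℤ, (t : ℚ) = trd x := by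
  obtain ⟨f, hf, hfx⟩ := hx
  -- Gauss's lemma: the minimal polynomial over `ℚ` has integer coefficients. It also divides `X² -
  -- trd x X + nrd x`.
  have hdvd : minpoly ℚ x ∣ f.map (algebraMap ℤ ℚ) :=
    minpoly.dvd _ _ (by rwa [Polynomial.aeval_map_algebraMap])
  obtain ⟨g, hg⟩ := IsIntegrallyClosed.eq_map_mul_C_of_dvd ℚ hf hdvd
  have hint : IsIntegral ℚ x := ⟨f.map (algebraMap ℤ ℚ), hf.map _, by
    rw [Polynomial.eval₂_map, ← IsScalarTower.algebraMap_eq]; exact hfx⟩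
  have hmonic := minpoly.monic hint
  rw [hmonic.leadingCoeff, Polynomial.C_1, mul_one] at hg
  let q : Polynomial ℚ := Polynomial.X ^ 2 + Polynomial.C (-trd x) * Polynomial.X +
    Polynomial.C (nrd x)
  have hqx : Polynomial.aeval x q = 0 := by
    have halg (c : ℚ) : algebraMap ℚ ℍ[ℚ,a,b] c = ⟨c, 0, 0, 0⟩ := rfl
    simp only [q, map_add, map_mul, sq, Polynomial.aeval_X, Polynomial.aeval_C, halg]
    ext <;> simp <;> simp only [trd, nrd] <;> ring
  have hqm : q.Monic := by unfold q; monicity!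
  have hqd : q.natDegree = 2 := by unfold q; compute_degree!
  have hqdvd : minpoly ℚ x ∣ q := minpoly.dvd _ _ hqx
  have hle := Polynomial.natDegree_le_of_dvd hqdvd hqm.ne_zero
  have hpos := minpoly.natDegree_pos hint
  rcases (by omega : (minpoly ℚ x).natDegree = 2 ∨ (minpoly ℚ x).natDegree = 1) with h | h
  · have hq : minpoly ℚ x = q :=
      (Polynomial.eq_of_monic_of_dvd_of_natDegree_le hmonic hqm hqdvd (by omega)).symm
    refine ⟨-g.coeff 1, ?_⟩
    have h1 : (g.coeff 1 : ℚ) = q.coeff 1 := by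
      rw [← hq, ← hg, Polynomial.coeff_map]; rfl
    push_cast
    rw [h1]
    simp [q, Polynomial.coeff_C]
  -- In degree one `x` is a rational integer, and its trace is twice that integer.
  · refine ⟨2 * -g.coeff 0, ?_⟩
    have h0 : (g.coeff 0 : ℚ) = (minpoly ℚ x).coeff 0 := by
      rw [← hg, Polynomial.coeff_map]; rfl
    have hx := minpoly.aeval ℚ x
    rw [hmonic.eq_X_add_C h, map_add, Polynomial.aeval_X, Polynomial.aeval_C] at hx
    have hre := congrArg QuaternionAlgebra.re hx
    simp at hre
    push_cast
    rw [h0, trd]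
    linarith

end Order

theorem int_dvd_of_forall_padicInt_dvd {n k : ℤ}
    (h : ∀ p : Nat.Primes, (n : ℤ_[p]) ∣ (k : ℤ_[p])) : n ∣ k := by
  rw [← Int.natAbs_dvd_natAbs, Nat.dvd_iff_prime_pow_dvd_dvd]
  intro p e hp he
  have : Fact p.Prime := ⟨hp⟩
  rw [← Int.natCast_dvd_natCast, Int.dvd_natAbs, Nat.cast_pow] at he ⊢
  rw [← PadicInt.pow_p_dvd_int_iff] at he ⊢
  exact he.trans (h ⟨p, hp⟩)

/-! ### Linking numbers modulo twice the reduced discriminant. -/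

section Linking

variable {a b : ℚ} {O : Subring ℍ[ℚ,a,b]} {D D₁ D₂ : ℤ}

theorem linking_comm (φ₁ : quadOrder D₁ →+* O) (φ₂ : quadOrder D₂ →+* O) :
    linking φ₁ φ₂ = linking φ₂ φ₁ := by
  rw [linking, linking, trd_mul_comm]

/-- The generator `(p_D + √D) / 2` of the quadratic order. -/
def quadGen (D : ℤ) : quadOrder D :=
  ⟨⟨((D % 2 : ℤ) : ℚ) / 2, 1 / 2⟩, Subring.subset_closure rfl⟩

theorem sqrtD_eq (D : ℤ) : sqrtD D = 2 * quadGen D - ((D % 2 : ℤ) : quadOrder D) := by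
  rw [two_mul]
  ext
  · simp [sqrtD, quadGen]
  · simp [sqrtD, quadGen]; norm_num

theorem map_sqrtD (φ : quadOrder D →+* O) :
    (φ (sqrtD D) : ℍ[ℚ,a,b]) = 2 * (φ (quadGen D) : ℍ[ℚ,a,b]) - ((D % 2 : ℤ) : ℍ[ℚ,a,b]) := by
  rw [sqrtD_eq, map_sub, map_mul, map_intCast, map_ofNat]
  rfl

/-- Passing from `√D` to the generators exposes the factor 2 of the modulus `2N`. -/
theorem linking_eq (φ₁ : quadOrder D₁ →+* O) (φ₂ : quadOrder D₂ →+* O) :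
    linking φ₁ φ₂ =
      2 * trd ((φ₁ (quadGen D₁) : ℍ[ℚ,a,b]) * (φ₂ (quadGen D₂) : ℍ[ℚ,a,b]))
      - (D₁ % 2 : ℤ) * trd (φ₂ (quadGen D₂) : ℍ[ℚ,a,b])
      - (D₂ % 2 : ℤ) * trd (φ₁ (quadGen D₁) : ℍ[ℚ,a,b]) + (D₁ % 2 : ℤ) * (D₂ % 2 : ℤ) := by
  rw [linking, map_sqrtD, map_sqrtD, two_mul, two_mul]
  simp [trd, sub_mul, mul_sub, add_mul, mul_add]
  ring

theorem exists_int_eq_linking (hO : IsOrder O) (φ₁ : quadOrder D₁ →+* O)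
    (φ₂ : quadOrder D₂ →+* O) : ∃ y : ℤ, (y : ℚ) = linking φ₁ φ₂ := by
  obtain ⟨t, ht⟩ := exists_int_eq_trd
    (hO.isIntegral (φ₁ (quadGen D₁) * φ₂ (quadGen D₂)).2)
  obtain ⟨t₁, ht₁⟩ := exists_int_eq_trd (hO.isIntegral (φ₁ (quadGen D₁)).2)
  obtain ⟨t₂, ht₂⟩ := exists_int_eq_trd (hO.isIntegral (φ₂ (quadGen D₂)).2)
  refine ⟨2 * t - (D₁ % 2) * t₂ - (D₂ % 2) * t₁ + (D₁ % 2) * (D₂ % 2), ?_⟩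
  rw [linking_eq, ← ht₁, ← ht₂, ← Subring.coe_mul, ← ht]
  push_cast
  rfl

theorem linking_sub_linking_of_equiv {N : ℕ} (hN : HasReducedDiscriminant O N) (p : Nat.Primes)
    {φ φ' : quadOrder D₁ →+* O} (ψ : quadOrder D₂ →+* O)
    (h : (orientation φ).atPrime p = (orientation φ').atPrime p) :
    ∃ c : ℤ_[p], ((linking φ' ψ - linking φ ψ : ℚ) : ℚ_[p]) = 2 * N * c := by
  obtain ⟨r, -, hr⟩ := Quotient.exact h
  have hconj : baseChange ℚ_[p] a b (φ' (quadGen D₁)) =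
      ((r : localOrder O p) : ℍ[ℚ_[p],(a : ℚ_[p]),(b : ℚ_[p])]) *
        baseChange ℚ_[p] a b (φ (quadGen D₁)) * ((r⁻¹ : (localOrder O p)ˣ) : localOrder O p) :=
    congrArg Subtype.val (hr (quadGen D₁))
  have h1 : ((r : localOrder O p) : ℍ[ℚ_[p],(a : ℚ_[p]),(b : ℚ_[p])]) *
      ((r⁻¹ : (localOrder O p)ˣ) : localOrder O p) = 1 :=
    congrArg Subtype.val r.mul_inv
  have h2 : (((r⁻¹ : (localOrder O p)ˣ) : localOrder O p) :
      ℍ[ℚ_[p],(a : ℚ_[p]),(b : ℚ_[p])]) * (r : localOrder O p) = 1 :=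
    congrArg Subtype.val r.inv_mul
  have hφ := baseChange_mem_localOrder O p (φ (quadGen D₁)).2
  have hψ := baseChange_mem_localOrder O p (ψ (quadGen D₂)).2
  obtain ⟨c, hc⟩ := exists_commForm_localOrder_eq hN p (r : localOrder O p).2 hφ
    ((localOrder O p).mul_mem ((r⁻¹ : (localOrder O p)ˣ) : localOrder O p).2 hψ)
  rw [← trd_conj_mul_sub h1, ← hconj, ← map_mul, ← map_mul, trd_baseChange,
    trd_baseChange] at hc
  -- Conjugation preserves the trace, so only the product term of `linking_eq` contributes to the
  -- difference.
  have htr : ((trd (φ' (quadGen D₁) : ℍ[ℚ,a,b]) : ℚ) : ℚ_[p]) =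
      ((trd (φ (quadGen D₁) : ℍ[ℚ,a,b]) : ℚ) : ℚ_[p]) := by
    rw [← trd_baseChange, ← trd_baseChange, hconj, trd_mul_comm, ← mul_assoc, h2, one_mul]
  refine ⟨c, ?_⟩
  rw [linking_eq, linking_eq, mul_assoc, ← hc]
  push_cast
  rw [htr]
  ring

theorem modEq_of_orientation_eq {N : ℕ} (hN : HasReducedDiscriminant O N)
    {φ φ' : quadOrder D₁ →+* O} (ψ : quadOrder D₂ →+* O) (h : orientation φ = orientation φ')
    {y y' : ℤ} (hy : (y : ℚ) = linking φ ψ) (hy' : (y' : ℚ) = linking φ' ψ) :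
    y ≡ y' [ZMOD 2 * N] := by
  refine Int.modEq_iff_dvd.mpr (int_dvd_of_forall_padicInt_dvd fun p => ?_)
  obtain ⟨c, hc⟩ := linking_sub_linking_of_equiv hN p ψ (congrArg (·.atPrime p) h)
  refine ⟨c, Subtype.coe_injective ?_⟩
  rw [← hy, ← hy'] at hc
  push_cast at hc ⊢
  exact hc

theorem linking_modEq (hO : IsOrder O) {N : ℕ} (hN : HasReducedDiscriminant O N)
    {φ₁ φ₁' : quadOrder D₁ →+* O} {φ₂ φ₂' : quadOrder D₂ →+* O}
    (h₁ : orientation φ₁ = orientation φ₁') (h₂ : orientation φ₂ = orientation φ₂')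
    {y y' : ℤ} (hy : (y : ℚ) = linking φ₁ φ₂) (hy' : (y' : ℚ) = linking φ₁' φ₂') :
    y ≡ y' [ZMOD 2 * N] := by
  -- The mixed pair `(φ₁', φ₂)` lets one embedding change at a time; symmetry of the linking number
  -- handles the second.
  obtain ⟨w, hw⟩ := exists_int_eq_linking hO φ₁' φ₂
  refine (modEq_of_orientation_eq hN φ₂ h₁ hy hw).trans ?_
  rw [linking_comm] at hw hy'
  exact modEq_of_orientation_eq hN φ₁' h₂ hw hy'

end Linking

end ShimuraLinking

theorem mainTheorem8 (a b : ℚ) (ha : a ≠ 0) (hb : b ≠ 0) (hB : IsIndefinite a b)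
    (O : Subring ℍ[ℚ,a,b]) (M : ℕ) (hO : IsEichlerOrderOfLevel O M)
    (D₁ D₂ : ℤ) (hD₁ : IsDiscriminant D₁) (hD₂ : IsDiscriminant D₂)
    (hpos₁ : 0 < D₁) (hpos₂ : 0 < D₂)
    (o₁ : EmbOrientation O D₁) (o₂ : EmbOrientation O D₂)
    (ho₁ : (optimalEmbeddings o₁).Nonempty) (ho₂ : (optimalEmbeddings o₂).Nonempty) :
    (∃ x₀ : ℤ, ∀ φ₁ ∈ optimalEmbeddings o₁, ∀ φ₂ ∈ optimalEmbeddings o₂,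
      ∃ y : ℤ, (y : ℚ) = linking φ₁ φ₂ ∧
        x₀ ≡ y [ZMOD 2 * (discriminant a b : ℤ) * (M : ℤ)]) ∧
    (∀ x x' : ℤ,
      (∃ φ₁ ∈ optimalEmbeddings o₁, ∃ φ₂ ∈ optimalEmbeddings o₂, IsLinked x φ₁ φ₂) →
      (∃ φ₁ ∈ optimalEmbeddings o₁, ∃ φ₂ ∈ optimalEmbeddings o₂, IsLinked x' φ₁ φ₂) →
      x ≡ x' [ZMOD 2 * (discriminant a b : ℤ) * (M : ℤ)]) := by
  have hN : (2 * (discriminant a b : ℤ) * (M : ℤ)) = 2 * ((discriminant a b * M : ℕ) : ℤ) := by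
    push_cast
    ring
  rw [hN]
  constructor
  · obtain ⟨ψ₁, hψ₁⟩ := ho₁
    obtain ⟨ψ₂, hψ₂⟩ := ho₂
    obtain ⟨x₀, hx₀⟩ := exists_int_eq_linking hO.1 ψ₁ ψ₂
    refine ⟨x₀, fun φ₁ hφ₁ φ₂ hφ₂ => ?_⟩
    obtain ⟨y, hy⟩ := exists_int_eq_linking hO.1 φ₁ φ₂
    exact ⟨y, hy, linking_modEq hO.1 hO.2.2 (hψ₁.2.trans hφ₁.2.symm) (hψ₂.2.trans hφ₂.2.symm)
      hx₀ hy⟩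
  · rintro x x' ⟨φ₁, hφ₁, φ₂, hφ₂, -, hx⟩ ⟨φ₁', hφ₁', φ₂', hφ₂', -, hx'⟩
    exact linking_modEq hO.1 hO.2.2 (hφ₁.2.trans hφ₁'.2.symm) (hφ₂.2.trans hφ₂'.2.symm) hx hx'
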